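/- Let $\mathcal G=(\mathcal X,\mathcal Y,\mathcal A,\mathcal B,\pi,V)$ be a nonlocal game: $\mathcal X,\mathcal Y$ are finite question sets, $\mathcal A,\mathcal B$ are finite nonempty answer sets, $\pi$ is a probability distribution on $\mathcal X\times\mathcal Y$, and $V:\mathcal A\times\mathcal B\times\mathcal X\times\mathcal Y\to\{0,1\}$. Put $c_{abxy}=\pi(x,y)V(a,b,x,y)$. A commuting operator strategy consists of a complex Hilbert space $\mathcal H$, a unit vector $\psi\in\mathcal H$, and POVMs $\{A_{ax}\}_{a\in\mathcal A}$ ($x\in\mathcal X$) and $\{B_{by}\}_{b\in\mathcal B}$ ($y\in\mathcal Y$) of bounded operators on $\mathcal H$ with $[A_{ax},B_{by}]=0$ for all $a,b,x,y$. Its winning probability is $\sum_{a,b,x,y}c_{abxy}\langle\psi,A_{ax}B_{by}\psi\rangle$, and $\omega^*_{qc}(\mathcal G)$ is the supremum of the winning probabilities over all commuting operator strategies. Let $\mathcal A_{PVM}^{\mathcal B,\mathcal Y}$ be the universal unital $C^*$-algebra generated by projections $N_{by}$ ($b\in\mathcal B$, $y\in\mathcal Y$), orthogonal for equal $y$ and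 different $b$, with $\sum_b N_{by}=I$ for every $y$. Let $(\mathcal A_{PVM}^{\mathcal B,\mathcal Y})_{\le k}$ be the linear span of all products of at most $k$ generators. For $d\ge 1$, the $d$-th level of the one-sided NPA hierarchy is the problem of maximizing $$\sum_{a,b,x,y}c_{abxy}\,\phi_{ax}(N_{by})$$ over all families of linear functionals $\phi_{ax}:(\mathcal A_{PVM}^{\mathcal B,\mathcal Y})_{\le 2d}\to\mathbb C$ ($a\in\mathcal A$, $x\in\mathcal X$) such that - $\sum_a\phi_{ax}=\sum_a\phi_{ax'}$ for all $x,x'\in\mathcal X$, - $\sum_a\phi_{ax}(I)=1$ for all $x\in\mathcal X$, - $\phi_{ax}(s^\dagger s)\ge 0$ for all $a,x$ and all $s\in(\mathcal A_{PVM}^{\mathcal B,\mathcal Y})_{\le d}$. Then for every $d\ge1$ the maximum is attained. Writing $\mathbb{p}^d(\mathcal G)$ for this optimal value, and with the supremum $\omega^*_{qc}(\mathcal G)$ being over a nonempty bounded set of reals, $$\lim_{d\to\infty}\mathbb{p}^d(\mathcal G)=\omega^*_{qc}(\mathcal G).$$ -/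

import Mathlib

universe u

namespace OneSidedNPA

open scoped ComplexOrder

/-! ### Nonlocal games and commuting operator strategies -/

/-- A nonlocal game with question sets `X` (Alice), `Y` (Bob) and answer sets `A` (Alice),
`B` (Bob): a probability distribution on the pairs of questions and a 0/1-valued verification
function. -/
structure NonlocalGame (X Y A B : Type u) [Fintype X] [Fintype Y] where
  prob : X → Y → ℝ
  prob_nonneg : ∀ x y, 0 ≤ prob x y
  prob_sum : ∑ x, ∑ y, prob x y = 1
  win : A → B → X → Y → Bool

/-- The coefficient `c_{abxy} = π(x,y) V(a,b,x,y)` of `M_{ax} N_{by}` in the game polynomial. -/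
def NonlocalGame.coeff {X Y A B : Type u} [Fintype X] [Fintype Y] (G : NonlocalGame X Y A B)
    (a : A) (b : B) (x : X) (y : Y) : ℝ :=
  G.prob x y * (if G.win a b x y then 1 else 0)

/-- A commuting operator strategy on the Hilbert space `H`: a unit vector and two families of
POVMs (one POVM for each question) such that Alice's operators commute with Bob's. -/
structure CommutingStrategy (X Y A B : Type u) [Fintype A] [Fintype B]
    (H : Type u) [NormedAddCommGroup H] [InnerProductSpace ℂ H] [CompleteSpace H] where
  psi : H
  norm_psi : ‖psi‖ = 1
  opA : A → X → (H →L[ℂ] H)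
  opB : B → Y → (H →L[ℂ] H)
  opA_pos : ∀ a x, (opA a x).IsPositive
  opB_pos : ∀ b y, (opB b y).IsPositive
  opA_sum : ∀ x, ∑ a, opA a x = 1
  opB_sum : ∀ y, ∑ b, opB b y = 1
  commute : ∀ a b x y, Commute (opA a x) (opB b y)

/-- The correlation `p(a,b|x,y) = ⟨ψ, A_{ax} B_{by} ψ⟩` (a real number, because the two
operators are positive and commute). -/
noncomputable def CommutingStrategy.corr {X Y A B : Type u} [Fintype A] [Fintype B]
    {H : Type u} [NormedAddCommGroup H] [InnerProductSpace ℂ H] [CompleteSpace H]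
    (S : CommutingStrategy X Y A B H) (a : A) (b : B) (x : X) (y : Y) : ℝ :=
  (inner ℂ S.psi ((S.opA a x * S.opB b y) S.psi)).re

/-- The set of winning probabilities of all commuting operator strategies for `G`. -/
def commutingValues {X Y A B : Type u} [Fintype X] [Fintype Y] [Fintype A] [Fintype B]
    (G : NonlocalGame X Y A B) : Set ℝ :=
  {w | ∃ (H : Type u) (_ : NormedAddCommGroup H) (_ : InnerProductSpace ℂ H)
      (_ : CompleteSpace H) (S : CommutingStrategy X Y A B H),
      w = ∑ a, ∑ b, ∑ x, ∑ y, G.coeff a b x y * S.corr a b x y}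

/-- The commuting operator value of `G`. -/
noncomputable def commutingValue {X Y A B : Type u} [Fintype X] [Fintype Y] [Fintype A]
    [Fintype B] (G : NonlocalGame X Y A B) : ℝ :=
  sSup (commutingValues G)

/-! ### The universal C*-algebra of a family of PVMs

The free unital *-algebra on self-adjoint generators `N_{by}` is completed with respect to the
largest C*-seminorm for which the PVM relations hold. -/

/-- The free unital complex algebra on the letters `(b, y)`, `b : B`, `y : Y`. -/
def PVMPoly (B Y : Type u) : Type u := MonoidAlgebra ℂ (FreeMonoid (B × Y))

namespace PVMPoly

variable {B Y : Type u}

noncomputable instance : Ring (PVMPoly B Y) :=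
  inferInstanceAs (Ring (MonoidAlgebra ℂ (FreeMonoid (B × Y))))

noncomputable instance : Algebra ℂ (PVMPoly B Y) :=
  inferInstanceAs (Algebra ℂ (MonoidAlgebra ℂ (FreeMonoid (B × Y))))

/-- The word `w` with coefficient `c`. -/
noncomputable def mono (w : FreeMonoid (B × Y)) (c : ℂ) : PVMPoly B Y :=
  MonoidAlgebra.single w c

/-- The generator `N_{by}`. -/
noncomputable def gen (b : B) (y : Y) : PVMPoly B Y := mono (FreeMonoid.of (b, y)) 1

lemma mono_mul (w w' : FreeMonoid (B × Y)) (c c' : ℂ) :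
    mono w c * mono w' c' = mono (w * w') (c * c') :=
  MonoidAlgebra.single_mul_single w w' c c'

lemma one_eq : (1 : PVMPoly B Y) = mono 1 1 := rfl

lemma smul_mono (r : ℂ) (w : FreeMonoid (B × Y)) (c : ℂ) :
    r • mono w c = mono w (r * c) :=
  MonoidAlgebra.smul_single r w c

lemma induction_mono {P : PVMPoly B Y → Prop} (x : PVMPoly B Y) (zero : P 0)
    (add : ∀ f g, P f → P g → P (f + g)) (single : ∀ w c, P (mono w c)) : P x :=
  MonoidAlgebra.induction_linear (motive := P) x zero add single

/-- The involution as an additive map: it conjugates coefficients and reverses words. -/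
noncomputable def starAddHom : PVMPoly B Y →+ PVMPoly B Y where
  toFun x := (MonoidAlgebra.coeff x).sum fun w c => mono (star w) (star c)
  map_zero' := Finsupp.sum_zero_index
  map_add' x y := by
    refine Finsupp.sum_add_index' (f := MonoidAlgebra.coeff x) (g := MonoidAlgebra.coeff y) ?_ ?_
    · intro w
      rw [star_zero]
      exact MonoidAlgebra.single_zero _
    · intro w c c'
      rw [star_add]
      exact MonoidAlgebra.single_add _ _ _

/-- The involution of the free *-algebra: the generators are self-adjoint. -/
noncomputable instance : Star (PVMPoly B Y) := ⟨starAddHom⟩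

lemma star_add' (x y : PVMPoly B Y) : star (x + y) = star x + star y := map_add starAddHom x y

lemma star_zero' : star (0 : PVMPoly B Y) = 0 := map_zero starAddHom

lemma star_mono (w : FreeMonoid (B × Y)) (c : ℂ) :
    star (mono w c) = mono (star w) (star c) := by
  refine Finsupp.sum_single_index (h := fun w c => mono (star w) (star c)) ?_
  rw [star_zero]
  exact MonoidAlgebra.single_zero _

lemma star_gen (b : B) (y : Y) : star (gen b y) = gen b y := by
  simp [gen, star_mono]

noncomputable instance : StarRing (PVMPoly B Y) where
  star_involutive x := by
    induction x using induction_mono with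
    | zero => simp only [star_zero']
    | add f g hf hg => rw [star_add', star_add', hf, hg]
    | single w c => rw [star_mono, star_mono, star_star, star_star]
  star_add := star_add'
  star_mul x y := by
    induction x using induction_mono with
    | zero => simp only [star_zero', zero_mul, mul_zero]
    | add f g hf hg => rw [add_mul, star_add', star_add', hf, hg, mul_add]
    | single w c =>
      induction y using induction_mono with
      | zero => simp only [star_zero', zero_mul, mul_zero]
      | add f g hf hg => rw [mul_add, star_add', star_add', hf, hg, add_mul]
      | single w' c' => simp only [mono_mul, star_mono, star_mul]

instance : StarModule ℂ (PVMPoly B Y) where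
  star_smul r x := by
    induction x using induction_mono with
    | zero => simp only [smul_zero, star_zero']
    | add f g hf hg => rw [smul_add, star_add', star_add', hf, hg, smul_add]
    | single w c => simp only [smul_mono, star_mono, star_mul', Complex.star_def]

/-- A C*-seminorm on the free *-algebra for which `(N_{by})_b` is a PVM for every `y`: the
`N_{by}` are projections (self-adjointness is built into the involution), pairwise orthogonal
for a fixed `y`, and sum to the identity. -/
structure IsPVMSeminorm [Fintype B] (p : Seminorm ℂ (PVMPoly B Y)) : Prop where
  mul_le : ∀ f g, p (f * g) ≤ p f * p g
  star_mul_self : ∀ f, p (star f * f) = p f ^ 2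
  idem : ∀ b y, p (gen b y * gen b y - gen b y) = 0
  orth : ∀ b b' y, b ≠ b' → p (gen b y * gen b' y) = 0
  sum_one : ∀ y, p (∑ b, gen b y - 1) = 0

lemma isPVMSeminorm_zero [Fintype B] :
    IsPVMSeminorm (0 : Seminorm ℂ (PVMPoly B Y)) := by
  constructor <;> simp

instance [Fintype B] : Nonempty {p : Seminorm ℂ (PVMPoly B Y) // IsPVMSeminorm p} :=
  ⟨⟨0, isPVMSeminorm_zero⟩⟩

section bounds

variable [Fintype B] {p : Seminorm ℂ (PVMPoly B Y)}

lemma IsPVMSeminorm.one_le (hp : IsPVMSeminorm p) : p 1 ≤ 1 := by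
  have h := hp.star_mul_self 1
  rw [star_one, one_mul] at h
  nlinarith [apply_nonneg p 1]

lemma IsPVMSeminorm.gen_le (hp : IsPVMSeminorm p) (b : B) (y : Y) : p (gen b y) ≤ 1 := by
  have h := hp.star_mul_self (gen b y)
  rw [star_gen] at h
  have h1 : p (gen b y * gen b y) ≤ p (gen b y * gen b y - gen b y) + p (gen b y) := by
    simpa using map_add_le_add p (gen b y * gen b y - gen b y) (gen b y)
  rw [hp.idem, h] at h1
  nlinarith [apply_nonneg p (gen b y)]

lemma IsPVMSeminorm.mono_le (hp : IsPVMSeminorm p) (w : FreeMonoid (B × Y)) :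
    p (mono w 1) ≤ 1 := by
  induction w using FreeMonoid.recOn with
  | one => exact hp.one_le
  | of_mul s w ih =>
    have h : mono (FreeMonoid.of s * w) (1 : ℂ) = gen s.1 s.2 * mono w 1 := by
      rw [gen, mono_mul, one_mul]
    rw [h]
    refine (hp.mul_le _ _).trans ?_
    exact mul_le_one₀ (hp.gen_le _ _) (apply_nonneg p _) ih

lemma exists_bound (x : PVMPoly B Y) :
    ∃ C, ∀ p : Seminorm ℂ (PVMPoly B Y), IsPVMSeminorm p → p x ≤ C := by
  induction x using induction_mono with
  | zero => exact ⟨0, fun p _ => by simp⟩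
  | add f g hf hg =>
    obtain ⟨C, hC⟩ := hf
    obtain ⟨D, hD⟩ := hg
    exact ⟨C + D, fun p hp => (map_add_le_add p f g).trans (add_le_add (hC p hp) (hD p hp))⟩
  | single w c =>
    refine ⟨‖c‖, fun p hp => ?_⟩
    have h : mono w c = c • mono w 1 := by rw [smul_mono, mul_one]
    rw [h, map_smul_eq_mul]
    exact mul_le_of_le_one_right (norm_nonneg c) (hp.mono_le w)

end bounds

/-- The largest C*-seminorm that satisfies the PVM relations. -/
noncomputable def univNorm [Fintype B] (x : PVMPoly B Y) : ℝ :=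
  ⨆ p : {p : Seminorm ℂ (PVMPoly B Y) // IsPVMSeminorm p}, p.1 x

section norm

variable [Fintype B]

lemma bddAbove (x : PVMPoly B Y) : BddAbove (Set.range
    fun p : {p : Seminorm ℂ (PVMPoly B Y) // IsPVMSeminorm p} => p.1 x) := by
  obtain ⟨C, hC⟩ := exists_bound x
  exact ⟨C, by rintro _ ⟨p, rfl⟩; exact hC p.1 p.2⟩

lemma le_univNorm {p : Seminorm ℂ (PVMPoly B Y)} (hp : IsPVMSeminorm p) (x : PVMPoly B Y) :
    p x ≤ univNorm x :=
  le_ciSup (bddAbove x) ⟨p, hp⟩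

lemma univNorm_le {x : PVMPoly B Y} {C : ℝ}
    (h : ∀ p : Seminorm ℂ (PVMPoly B Y), IsPVMSeminorm p → p x ≤ C) : univNorm x ≤ C :=
  ciSup_le fun p => h p.1 p.2

lemma univNorm_nonneg (x : PVMPoly B Y) : 0 ≤ univNorm x :=
  le_univNorm isPVMSeminorm_zero x

lemma univNorm_star_mul_self (x : PVMPoly B Y) : univNorm (star x * x) = univNorm x ^ 2 := by
  apply le_antisymm
  · refine univNorm_le fun p hp => ?_
    rw [hp.star_mul_self]
    exact pow_le_pow_left₀ (apply_nonneg p x) (le_univNorm hp x) 2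
  · have h : univNorm x ≤ Real.sqrt (univNorm (star x * x)) := by
      refine univNorm_le fun p hp => Real.le_sqrt_of_sq_le ?_
      rw [← hp.star_mul_self]
      exact le_univNorm hp _
    calc univNorm x ^ 2 ≤ Real.sqrt (univNorm (star x * x)) ^ 2 :=
          pow_le_pow_left₀ (univNorm_nonneg x) h 2
      _ = univNorm (star x * x) := Real.sq_sqrt (univNorm_nonneg _)

lemma univNorm_mul_le (x y : PVMPoly B Y) : univNorm (x * y) ≤ univNorm x * univNorm y :=
  univNorm_le fun p hp => (hp.mul_le x y).trans
    (mul_le_mul (le_univNorm hp x) (le_univNorm hp y) (apply_nonneg p y) (univNorm_nonneg x))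

lemma univNorm_add_le (x y : PVMPoly B Y) : univNorm (x + y) ≤ univNorm x + univNorm y :=
  univNorm_le fun p hp => (map_add_le_add p x y).trans
    (add_le_add (le_univNorm hp x) (le_univNorm hp y))

lemma univNorm_smul_le (r : ℂ) (x : PVMPoly B Y) : univNorm (r • x) ≤ ‖r‖ * univNorm x :=
  univNorm_le fun p hp => by
    rw [map_smul_eq_mul]
    exact mul_le_mul_of_nonneg_left (le_univNorm hp x) (norm_nonneg r)

lemma univNorm_star_le (x : PVMPoly B Y) : univNorm (star x) ≤ univNorm x := by
  have h := univNorm_star_mul_self (star x)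
  rw [star_star] at h
  have h1 := univNorm_mul_le x (star x)
  rw [h, pow_two] at h1
  rcases (univNorm_nonneg (star x)).eq_or_lt with h0 | h0
  · rw [← h0]
    exact univNorm_nonneg x
  · exact le_of_mul_le_mul_right h1 h0

lemma univNorm_star (x : PVMPoly B Y) : univNorm (star x) = univNorm x :=
  le_antisymm (univNorm_star_le x) (by simpa using univNorm_star_le (star x))

noncomputable instance : SeminormedRing (PVMPoly B Y) :=
  RingSeminorm.toSeminormedRing
    { toFun := univNorm
      map_zero' := le_antisymm (univNorm_le fun p _ => by simp) (univNorm_nonneg 0)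
      add_le' := univNorm_add_le
      neg' := fun x => by
        simp only [univNorm, map_neg_eq_map]
      mul_le' := univNorm_mul_le }

lemma norm_eq (x : PVMPoly B Y) : ‖x‖ = univNorm x := rfl

noncomputable instance : NormedSpace ℂ (PVMPoly B Y) where
  norm_smul_le := univNorm_smul_le

lemma norm_star' (x : PVMPoly B Y) : ‖star x‖ = ‖x‖ := univNorm_star x

lemma norm_star_mul_self' (x : PVMPoly B Y) : ‖star x * x‖ = ‖x‖ * ‖x‖ := by
  rw [← pow_two]
  exact univNorm_star_mul_self x

lemma isometry_star : Isometry (star : PVMPoly B Y → PVMPoly B Y) :=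
  AddMonoidHomClass.isometry_of_norm (starAddHom : PVMPoly B Y →+ PVMPoly B Y) norm_star'

end norm

end PVMPoly

open UniformSpace in
/-- The PVM algebra: the universal C*-algebra generated by projections `N_{by}` with
`∑ b, N_{by} = 1` for every `y`, as the (Hausdorff) completion of the free *-algebra. -/
def PVMAlgebra (B Y : Type u) [Fintype B] : Type u := Completion (PVMPoly B Y)

namespace PVMAlgebra

open UniformSpace

variable {B Y : Type u} [Fintype B]

noncomputable instance : NormedRing (PVMAlgebra B Y) :=
  inferInstanceAs (NormedRing (Completion (PVMPoly B Y)))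

instance : CompleteSpace (PVMAlgebra B Y) :=
  inferInstanceAs (CompleteSpace (Completion (PVMPoly B Y)))

noncomputable instance : Algebra ℂ (PVMAlgebra B Y) :=
  inferInstanceAs (Algebra ℂ (Completion (PVMPoly B Y)))

/-- The canonical map from the free *-algebra. -/
noncomputable def of (x : PVMPoly B Y) : PVMAlgebra B Y := (x : Completion (PVMPoly B Y))

lemma of_mul (x y : PVMPoly B Y) : of (x * y) = of x * of y := Completion.coe_mul x y

lemma of_add (x y : PVMPoly B Y) : of (x + y) = of x + of y := Completion.coe_add x y

lemma of_smul (r : ℂ) (x : PVMPoly B Y) : of (r • x) = r • of x := Completion.coe_smul r x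

lemma norm_of (x : PVMPoly B Y) : ‖of x‖ = ‖x‖ := Completion.norm_coe x

lemma continuous_of : Continuous (of : PVMPoly B Y → PVMAlgebra B Y) :=
  Completion.continuous_coe _

lemma induction_of {P : PVMAlgebra B Y → Prop} (x : PVMAlgebra B Y) (hc : IsClosed {x | P x})
    (h : ∀ f, P (of f)) : P x :=
  Completion.induction_on x hc h

noncomputable instance : NormedAlgebra ℂ (PVMAlgebra B Y) where
  norm_smul_le := norm_smul_le (α := ℂ) (β := Completion (PVMPoly B Y))

noncomputable instance : Star (PVMAlgebra B Y) :=
  ⟨Completion.map (star : PVMPoly B Y → PVMPoly B Y)⟩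

lemma star_of (x : PVMPoly B Y) : star (of x) = of (star x) :=
  Completion.map_coe PVMPoly.isometry_star.uniformContinuous x

lemma continuous_star' : Continuous (star : PVMAlgebra B Y → PVMAlgebra B Y) :=
  Completion.continuous_map

noncomputable instance : StarRing (PVMAlgebra B Y) where
  star_involutive x := by
    induction x using induction_of with
    | hc => exact isClosed_eq (continuous_star'.comp continuous_star') continuous_id
    | h f => rw [star_of, star_of, star_star]
  star_add x y := by
    induction x using induction_of with
    | hc =>
      exact isClosed_eq (continuous_star'.comp (continuous_id.add continuous_const))
        (continuous_star'.add continuous_const)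
    | h f =>
      induction y using induction_of with
      | hc =>
        exact isClosed_eq (continuous_star'.comp (continuous_const.add continuous_id))
          (continuous_const.add continuous_star')
      | h g => simp only [← of_add, star_of, star_add]
  star_mul x y := by
    induction x using induction_of with
    | hc =>
      exact isClosed_eq (continuous_star'.comp (continuous_id.mul continuous_const))
        (continuous_const.mul continuous_star')
    | h f =>
      induction y using induction_of with
      | hc =>
        exact isClosed_eq (continuous_star'.comp (continuous_const.mul continuous_id))
          (continuous_star'.mul continuous_const)
      | h g => simp only [← of_mul, star_of, star_mul]

noncomputable instance : CStarAlgebra (PVMAlgebra B Y) where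
  norm_mul_self_le x := by
    refine le_of_eq ?_
    induction x using induction_of with
    | hc =>
      exact isClosed_eq (continuous_norm.mul continuous_norm)
        (continuous_norm.comp (continuous_star'.mul continuous_id))
    | h f => rw [star_of, ← of_mul, norm_of, norm_of, PVMPoly.norm_star_mul_self']
  star_smul r x := by
    induction x using induction_of with
    | hc =>
      exact isClosed_eq (continuous_star'.comp (continuous_const_smul r))
        (continuous_star'.const_smul (star r))
    | h f => simp only [← of_smul, star_of, star_smul]

/-- The generator `N_{by}` of the PVM algebra. -/
noncomputable def N (b : B) (y : Y) : PVMAlgebra B Y := of (PVMPoly.gen b y)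

lemma star_N (b : B) (y : Y) : star (N b y) = N b y := by
  rw [N, star_of, PVMPoly.star_gen]

/-- The polynomials of degree at most `k` in the generators: the linear span of all products
of at most `k` generators. -/
noncomputable def polyLE (B Y : Type u) [Fintype B] (k : ℕ) : Submodule ℂ (PVMAlgebra B Y) :=
  Submodule.span ℂ {w | ∃ l : List (B × Y), l.length ≤ k ∧ w = (l.map fun s => N s.1 s.2).prod}

lemma one_mem_polyLE (k : ℕ) : (1 : PVMAlgebra B Y) ∈ polyLE B Y k :=
  Submodule.subset_span ⟨[], by simp, by simp⟩

lemma N_mem_polyLE {k : ℕ} (hk : 1 ≤ k) (b : B) (y : Y) : N b y ∈ polyLE B Y k :=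
  Submodule.subset_span ⟨[(b, y)], by simpa using hk, by simp⟩

lemma mul_mem_polyLE {j k : ℕ} {s t : PVMAlgebra B Y} (hs : s ∈ polyLE B Y j)
    (ht : t ∈ polyLE B Y k) : s * t ∈ polyLE B Y (j + k) := by
  have h := Submodule.mul_mem_mul hs ht
  rw [polyLE, polyLE, Submodule.span_mul_span] at h
  refine Submodule.span_mono ?_ h
  rintro _ ⟨_, ⟨l, hl, rfl⟩, _, ⟨l', hl', rfl⟩, rfl⟩
  exact ⟨l ++ l', by rw [List.length_append]; exact add_le_add hl hl', by simp⟩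

lemma star_mem_polyLE {k : ℕ} {s : PVMAlgebra B Y} (hs : s ∈ polyLE B Y k) :
    star s ∈ polyLE B Y k := by
  rw [polyLE] at hs
  induction hs using Submodule.span_induction with
  | mem w hw =>
    obtain ⟨l, hl, rfl⟩ := hw
    refine Submodule.subset_span ⟨l.reverse, by simpa using hl, ?_⟩
    clear hl
    induction l with
    | nil => simp
    | cons s l ih => simp [ih, star_N]
  | zero => rw [star_zero]; exact zero_mem _
  | add s t _ _ h h' => rw [star_add]; exact add_mem h h'
  | smul r s _ h => rw [star_smul]; exact Submodule.smul_mem _ _ h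

lemma star_mul_self_mem_polyLE {d : ℕ} {s : PVMAlgebra B Y} (hs : s ∈ polyLE B Y d) :
    star s * s ∈ polyLE B Y (2 * d) := by
  rw [two_mul]
  exact mul_mem_polyLE (star_mem_polyLE hs) hs

end PVMAlgebra

/-! ### The one-sided NPA hierarchy -/

open PVMAlgebra

/-- Feasibility at level `d` of the one-sided NPA hierarchy: the linear functionals `φ a x` on
Bob's polynomials of degree at most `2 d` have a common marginal, which is normalized, and each
of them is nonnegative on `s† s` for every `s` of degree at most `d` (in the order of `ℂ`, i.e.
the value is real and nonnegative). -/
structure IsFeasible {X Y A B : Type u} [Fintype A] [Fintype B] (d : ℕ)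
    (φ : A → X → (polyLE B Y (2 * d) →ₗ[ℂ] ℂ)) : Prop where
  consistency : ∀ x x', ∑ a, φ a x = ∑ a, φ a x'
  identity : ∀ x, ∑ a, φ a x ⟨1, one_mem_polyLE (2 * d)⟩ = 1
  positivity : ∀ a x (s : PVMAlgebra B Y) (hs : s ∈ polyLE B Y d),
    0 ≤ φ a x ⟨star s * s, star_mul_self_mem_polyLE hs⟩

/-- The objective `∑ c_{abxy} φ_{ax}(N_{by})` at level `d ≥ 1` (for feasible `φ` the numbers
`φ_{ax}(N_{by}) = φ_{ax}(N_{by}† N_{by})` are real). -/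
noncomputable def objective {X Y A B : Type u} [Fintype X] [Fintype Y] [Fintype A] [Fintype B]
    (G : NonlocalGame X Y A B) (d : ℕ+)
    (φ : A → X → (polyLE B Y (2 * d) →ₗ[ℂ] ℂ)) : ℝ :=
  ∑ a, ∑ b, ∑ x, ∑ y, G.coeff a b x y *
    (φ a x ⟨N b y, N_mem_polyLE (Nat.mul_pos two_pos d.pos) b y⟩).re

/-- The objective values of the feasible points of level `d ≥ 1`. -/
def oneSidedValues {X Y A B : Type u} [Fintype X] [Fintype Y] [Fintype A] [Fintype B]
    (G : NonlocalGame X Y A B) (d : ℕ+) : Set ℝ :=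
  {w | ∃ φ : A → X → (polyLE B Y (2 * d) →ₗ[ℂ] ℂ), IsFeasible (d : ℕ) φ ∧ w = objective G d φ}

/-- The optimal value of level `d ≥ 1` of the one-sided NPA hierarchy. -/
noncomputable def oneSidedValue {X Y A B : Type u} [Fintype X] [Fintype Y] [Fintype A]
    [Fintype B] (G : NonlocalGame X Y A B) (d : ℕ+) : ℝ :=
  sSup (oneSidedValues G d)

end OneSidedNPA

/-! The proof squeezes every limit point of the level values between lower and upper bounds by the
commuting value.

A commuting strategy gives a feasible point at every level. Its second POVM family need not be
projective, so it is dilated simultaneously for all `y` (`exists_dilation`) to a representation `π`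
of the PVM algebra by operator matrices whose polynomial entries commute with Alice's operators. The
functionals `z ↦ ⟨ψ, A_{ax} π(z)_{i₀i₀} ψ⟩` are feasible, because `π(s† s)_{i₀i₀}` is a sum of terms
`T† T` and `A_{ax}` can be moved between the two factors. So every level value is at least the
commuting value.

Conversely, feasible functionals are bounded at each fixed polynomial, uniformly in the level
(`exists_forall_norm_le`), so they converge pointwise along ultrafilters
(`exists_limit_of_isFeasible`). At a fixed level the limit is again feasible, which gives
attainment. As the level tends to infinity, the limits are positive functionals on the *-algebra of
all polynomials with a common normalized marginal `f`. In the GNS space of `f`, Bob acts by left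
multiplication, and Alice's operators are the Radon–Nikodym derivatives of the `φ_{ax}` with respect
to `f`, which commute with left multiplication (`exists_strategy_of_positiveFunctional`). The limit
value is therefore won by a commuting strategy. -/

namespace OneSidedNPA

open scoped ComplexOrder
open Filter Topology PVMAlgebra

/-! ### Evaluation of polynomials and the universal property of the PVM algebra. -/

namespace PVMPoly

variable {B Y : Type u}

/-- The evaluation of noncommutative polynomials at a family of elements of an algebra. -/
noncomputable def eval {D : Type*} [Ring D] [Algebra ℂ D] (P : B → Y → D) :
    PVMPoly B Y →ₐ[ℂ] D :=
  MonoidAlgebra.lift ℂ D (FreeMonoid (B × Y)) (FreeMonoid.lift fun s => P s.1 s.2)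

lemma eval_mono {D : Type*} [Ring D] [Algebra ℂ D] (P : B → Y → D)
    (w : FreeMonoid (B × Y)) (c : ℂ) :
    eval P (mono w c) = c • FreeMonoid.lift (fun s => P s.1 s.2) w :=
  MonoidAlgebra.lift_single _ _ _

lemma eval_gen {D : Type*} [Ring D] [Algebra ℂ D] (P : B → Y → D) (b : B) (y : Y) :
    eval P (gen b y) = P b y := by
  rw [gen, eval_mono, one_smul, FreeMonoid.lift_eval_of]

lemma eval_star {D : Type*} [Ring D] [StarRing D] [Algebra ℂ D] [StarModule ℂ D] {P : B → Y → D}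
    (hP : ∀ b y, star (P b y) = P b y) (f : PVMPoly B Y) :
    eval P (star f) = star (eval P f) := by
  induction f using induction_mono with
  | zero => simp
  | add f g hf hg => rw [star_add, map_add, map_add, star_add, hf, hg]
  | single w c =>
    rw [star_mono, eval_mono, eval_mono, star_smul]
    congr 1
    induction w using FreeMonoid.recOn with
    | one => simp
    | of_mul s w ih => rw [star_mul, map_mul, map_mul, star_mul, ih]; simp [hP]

end PVMPoly

namespace PVMAlgebra

open UniformSpace

variable {B Y : Type u} [Fintype B]

lemma of_one : (of 1 : PVMAlgebra B Y) = 1 := rfl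

/-- The canonical map from the free *-algebra, as a linear map. -/
noncomputable def ofₗ : PVMPoly B Y →ₗ[ℂ] PVMAlgebra B Y where
  toFun := of
  map_add' := of_add
  map_smul' := of_smul

/-- The norm of the completion is the supremum of the PVM seminorms, so what none of them separates
is identified. This turns the defining relations into equations. -/
lemma of_eq_of {x y : PVMPoly B Y}
    (h : ∀ p : Seminorm ℂ (PVMPoly B Y), PVMPoly.IsPVMSeminorm p → p (x - y) = 0) :
    (of x : PVMAlgebra B Y) = of y := by
  have h1 : ‖(of (x - y) : PVMAlgebra B Y)‖ = 0 := by
    rw [norm_of, PVMPoly.norm_eq]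
    exact le_antisymm (PVMPoly.univNorm_le fun p hp => (h p hp).le) (PVMPoly.univNorm_nonneg _)
  have h2 : (of (x - y) : PVMAlgebra B Y) = of x - of y := map_sub ofₗ x y
  rwa [norm_eq_zero, h2, sub_eq_zero] at h1

lemma N_mul_self (b : B) (y : Y) : N b y * N b y = N b y := by
  rw [N, ← of_mul]
  exact of_eq_of fun p hp => hp.idem b y

lemma sum_N (y : Y) : ∑ b : B, N b y = 1 := by
  have h : ∑ b : B, N b y = of (∑ b : B, PVMPoly.gen b y) := (map_sum ofₗ _ _).symm
  rw [h, ← of_one]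
  exact of_eq_of fun p hp => hp.sum_one y

/-- The universal property of the PVM algebra: every family of PVMs in a C*-algebra is the image
of the generators under a *-homomorphism. -/
theorem exists_lift {D : Type*} [CStarAlgebra D] (P : B → Y → D)
    (hstar : ∀ b y, star (P b y) = P b y) (hidem : ∀ b y, P b y * P b y = P b y)
    (horth : ∀ b b' y, b ≠ b' → P b y * P b' y = 0) (hsum : ∀ y, ∑ b, P b y = 1) :
    ∃ π : PVMAlgebra B Y →⋆ₐ[ℂ] D, ∀ b y, π (N b y) = P b y := by
  -- The norm of `D` pulled back along evaluation is one of the seminorms in the supremum, so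
  -- evaluation is contractive for the universal norm and extends to the completion.
  let p : Seminorm ℂ (PVMPoly B Y) :=
    Seminorm.of (fun f => ‖PVMPoly.eval P f‖)
      (fun f g => by rw [map_add]; exact norm_add_le _ _)
      (fun r f => by rw [map_smul, norm_smul])
  have hp : PVMPoly.IsPVMSeminorm p := by
    have hpe : ∀ f, p f = ‖PVMPoly.eval P f‖ := fun _ => rfl
    constructor
    · intro f g
      rw [hpe, hpe, hpe, map_mul]
      exact norm_mul_le _ _
    · intro f
      rw [hpe, hpe, map_mul, PVMPoly.eval_star hstar, CStarRing.norm_star_mul_self, pow_two]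
    · intro b y
      rw [hpe, map_sub, map_mul, PVMPoly.eval_gen, hidem, sub_self, norm_zero]
    · intro b b' y h
      rw [hpe, map_mul, PVMPoly.eval_gen, PVMPoly.eval_gen, horth b b' y h, norm_zero]
    · intro y
      rw [hpe, map_sub, map_sum, map_one]
      simp only [PVMPoly.eval_gen, hsum, sub_self, norm_zero]
  have hcont : Continuous (PVMPoly.eval P) :=
    AddMonoidHomClass.continuous_of_bound (PVMPoly.eval P) (1 : ℝ) fun f => by
      rw [one_mul]
      exact PVMPoly.le_univNorm hp f
  let π : PVMAlgebra B Y →+* D := Completion.extensionHom (PVMPoly.eval P).toRingHom hcont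
  have hπ : ∀ f, π (of f) = PVMPoly.eval P f := fun f =>
    Completion.extensionHom_coe (PVMPoly.eval P).toRingHom hcont f
  have hπc : Continuous π := Completion.continuous_extension
  refine ⟨{ toFun := π, map_one' := map_one π, map_mul' := map_mul π, map_zero' := map_zero π,
            map_add' := map_add π, commutes' := fun r => ?_, map_star' := fun z => ?_ },
    fun b y => (hπ _).trans (PVMPoly.eval_gen P b y)⟩
  · have h : (algebraMap ℂ (PVMAlgebra B Y)) r = of (r • 1) := by
      rw [of_smul, of_one, Algebra.algebraMap_eq_smul_one]
    rw [h]
    exact (hπ _).trans (by rw [map_smul, map_one, Algebra.algebraMap_eq_smul_one])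
  · induction z using induction_of with
    | hc => exact isClosed_eq (hπc.comp continuous_star') (continuous_star.comp hπc)
    | h f => rw [star_of, hπ, hπ, PVMPoly.eval_star hstar]

end PVMAlgebra

/-! ### Pointwise compactness and bounds independent of the level. -/

/-- A pointwise bounded family of linear functionals converges pointwise along an ultrafilter. -/
lemma exists_tendsto_ultrafilter {ι V : Type*} [AddCommGroup V] [Module ℂ V] (U : Ultrafilter ι)
    (g : ι → V →ₗ[ℂ] ℂ) (hg : ∀ z, ∃ C, ∀ᶠ i in U, ‖g i z‖ ≤ C) :
    ∃ F : V →ₗ[ℂ] ℂ, ∀ z, Tendsto (fun i => g i z) U (𝓝 (F z)) := by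
  have h : ∀ z, ∃ w, Tendsto (fun i => g i z) U (𝓝 w) := fun z => by
    obtain ⟨C, hC⟩ := hg z
    obtain ⟨w, -, hw⟩ := (isCompact_closedBall (0 : ℂ) C).ultrafilter_le_nhds
      (U.map fun i => g i z) (by
        rw [le_principal_iff, Ultrafilter.coe_map, Filter.mem_map]
        filter_upwards [hC] with i hi
        simpa using hi)
    exact ⟨w, hw⟩
  choose F hF using h
  refine ⟨{ toFun := F, map_add' := fun z w => ?_, map_smul' := fun r z => ?_ }, hF⟩
  · refine tendsto_nhds_unique (hF (z + w)) ?_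
    simpa only [map_add] using (hF z).add (hF w)
  · refine tendsto_nhds_unique (hF (r • z)) ?_
    simpa only [map_smul, RingHom.id_apply] using (hF z).const_smul r

section bounds

variable {B Y : Type u} [Fintype B]

/-- A linear functional that is nonnegative on the squares of degree `2 d` is bounded on the
squares of the words of length at most `d`. -/
lemma map_star_mul_self_word_le {d : ℕ} {f : PVMAlgebra B Y →ₗ[ℂ] ℂ}
    (hf : ∀ s ∈ polyLE B Y d, 0 ≤ f (star s * s)) (l : List (B × Y)) (hl : l.length ≤ d) :
    f (star (l.map fun s => N s.1 s.2).prod * (l.map fun s => N s.1 s.2).prod) ≤ f 1 := by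
  induction l with
  | nil => simp
  | cons t l ih =>
    refine le_trans ?_ (ih ((Nat.le_succ _).trans hl))
    set u := (l.map fun s => N s.1 s.2).prod with hu
    -- Since `N` is a projection, the square of `u - N u` is `u† u - (N u)† (N u)`; positivity there
    -- says that prepending a letter does not increase the value.
    have hmem : u - N t.1 t.2 * u ∈ polyLE B Y d := by
      refine sub_mem (Submodule.subset_span ⟨l, (Nat.le_succ _).trans hl, rfl⟩)
        (Submodule.subset_span ⟨t :: l, hl, ?_⟩)
      rw [List.map_cons, List.prod_cons]
    have h := hf _ hmem
    have hN := N_mul_self t.1 t.2 (B := B)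
    have h1 : star (N t.1 t.2 * u) * (N t.1 t.2 * u) = star u * N t.1 t.2 * u := by
      rw [star_mul, star_N, mul_assoc, ← mul_assoc (N t.1 t.2), hN, mul_assoc]
    have h2 : star (u - N t.1 t.2 * u) * (u - N t.1 t.2 * u) =
        star u * u - star u * N t.1 t.2 * u := by
      rw [star_sub, sub_mul, mul_sub, mul_sub, h1, star_mul, star_N, mul_assoc]
      abel
    rw [h2, map_sub, sub_nonneg] at h
    rwa [List.map_cons, List.prod_cons, h1]

/-- Polarization reduces arbitrary products `u† v` to squares, the only elements on which positivity
gives information. -/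
lemma four_smul_star_mul {R : Type*} [Ring R] [StarRing R] [Algebra ℂ R] [StarModule ℂ R]
    (u v : R) :
    (4 : ℂ) • (star u * v) = star (u + v) * (u + v) - star (u - v) * (u - v)
      - Complex.I • (star (u + Complex.I • v) * (u + Complex.I • v))
      + Complex.I • (star (u - Complex.I • v) * (u - Complex.I • v)) := by
  have hI : star Complex.I = -Complex.I := Complex.conj_I
  simp only [star_add, star_sub, star_smul, hI, add_mul, mul_add, sub_mul, mul_sub,
    smul_mul_assoc, mul_smul_comm, smul_add, smul_sub, smul_smul, neg_smul, neg_mul, smul_neg,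
    Complex.I_mul_I, neg_neg, one_smul]
  module

/-- For `|r| = 1` the parallelogram law bounds the value at the square of `u + r v` by `4 C`, as the
term for `-r` is nonnegative. Polarization then gives `4 · 4 C` for four times the product. The
constant is not sharp; only its independence of `f` matters. -/
lemma norm_map_star_mul_le {R : Type*} [Ring R] [StarRing R] [Algebra ℂ R] [StarModule ℂ R]
    {f : R →ₗ[ℂ] ℂ} {u v : R} {C : ℝ}
    (hf : ∀ r : ℂ, 0 ≤ f (star (u + r • v) * (u + r • v)))
    (hu : f (star u * u) ≤ C) (hv : f (star v * v) ≤ C) :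
    ‖f (star u * v)‖ ≤ 4 * C := by
  have key : ∀ r : ℂ, star r * r = 1 → ‖f (star (u + r • v) * (u + r • v))‖ ≤ 4 * C := by
    intro r hr
    have hsum : f (star (u + r • v) * (u + r • v)) + f (star (u + (-r) • v) * (u + (-r) • v)) =
        2 * f (star u * u) + 2 * f (star v * v) := by
      have h : star (u + r • v) * (u + r • v) + star (u + (-r) • v) * (u + (-r) • v) =
          (2 : ℂ) • (star u * u) + (2 * (star r * r)) • (star v * v) := by
        simp only [star_add, star_smul, add_mul, mul_add, smul_mul_assoc, mul_smul_comm,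
          star_neg, neg_smul, smul_add, neg_mul, mul_neg]
        module
      rw [← map_add, h, hr, map_add, map_smul, map_smul]
      simp
    have h1 := hf r
    have h2 := hf (-r)
    rw [← Complex.real_le_real, ← Complex.eq_coe_norm_of_nonneg h1]
    refine (le_add_of_nonneg_right h2).trans (hsum.le.trans ?_)
    calc _ ≤ (2 : ℂ) * C + 2 * C := by gcongr
      _ = _ := by push_cast; ring
  have h4 : ‖(4 : ℂ) * f (star u * v)‖ ≤ 4 * C + 4 * C + 4 * C + 4 * C := by
    rw [← smul_eq_mul, ← map_smul, four_smul_star_mul, map_add, map_sub, map_sub, map_smul,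
      map_smul]
    have e1 := key 1 (by simp)
    have e2 := key (-1) (by simp)
    have e3 := key Complex.I (by simp)
    have e4 := key (-Complex.I) (by simp)
    simp only [one_smul, neg_smul, ← sub_eq_add_neg] at e1 e2 e3 e4
    refine (norm_add_le _ _).trans (add_le_add ((norm_sub_le _ _).trans
      (add_le_add ((norm_sub_le _ _).trans (add_le_add e1 e2)) ?_)) ?_)
    · simpa using e3
    · simpa using e4
  rw [norm_mul] at h4
  norm_num at h4
  linarith

/-- The linear functionals that are nonnegative on squares of degree at most `2 d` and at most
`1` at the identity are bounded at every polynomial of degree at most `2 d`, uniformly in the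
functional and in the degree. -/
lemma exists_forall_norm_le {k : ℕ} {z : PVMAlgebra B Y} (hz : z ∈ polyLE B Y (2 * k)) :
    ∃ C : ℝ, ∀ d, k ≤ d → ∀ f : PVMAlgebra B Y →ₗ[ℂ] ℂ,
      (∀ s ∈ polyLE B Y d, 0 ≤ f (star s * s)) → f 1 ≤ 1 → ‖f z‖ ≤ C := by
  rw [polyLE] at hz
  induction hz using Submodule.span_induction with
  | mem w hw =>
    obtain ⟨l, hl, rfl⟩ := hw
    refine ⟨4 * 1, fun d hd f hf h1 => ?_⟩
    have hmem : ∀ l' : List (B × Y), l'.length ≤ d →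
        (l'.map fun s => N s.1 s.2).prod ∈ polyLE B Y d := fun l' h =>
      Submodule.subset_span ⟨l', h, rfl⟩
    -- A word of length at most `2 k` is cut into two pieces of length at most `k ≤ d`, so that
    -- positivity on squares of degree `d` controls both.
    have h₁ : ((l.take k).reverse).length ≤ d := by simp; omega
    have h₂ : (l.drop k).length ≤ d := by simp; omega
    have hsplit : (l.map fun s => N s.1 s.2).prod =
        star (((l.take k).reverse).map fun s => N s.1 s.2).prod *
          ((l.drop k).map fun s => N s.1 s.2).prod := by
      have hrev : ∀ l' : List (B × Y), star ((l'.reverse).map fun s => N s.1 s.2).prod =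
          (l'.map fun s => N s.1 s.2).prod := by
        intro l'
        induction l' with
        | nil => simp
        | cons s l' ih => simp [star_N, ← ih]
      rw [hrev, ← List.prod_append, ← List.map_append, List.take_append_drop]
    rw [hsplit]
    exact norm_map_star_mul_le
      (fun r => hf _ (add_mem (hmem _ h₁) (Submodule.smul_mem _ _ (hmem _ h₂))))
      (by simpa using (map_star_mul_self_word_le hf _ h₁).trans h1)
      (by simpa using (map_star_mul_self_word_le hf _ h₂).trans h1)
  | zero => exact ⟨0, fun d _ f _ _ => by simp⟩
  | add s t _ _ h h' =>
    obtain ⟨C, hC⟩ := h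
    obtain ⟨C', hC'⟩ := h'
    refine ⟨C + C', fun d hd f hf h1 => ?_⟩
    rw [map_add]
    exact (norm_add_le _ _).trans (add_le_add (hC d hd f hf h1) (hC' d hd f hf h1))
  | smul r s _ h =>
    obtain ⟨C, hC⟩ := h
    refine ⟨‖r‖ * C, fun d hd f hf h1 => ?_⟩
    rw [map_smul, smul_eq_mul, norm_mul]
    exact mul_le_mul_of_nonneg_left (hC d hd f hf h1) (norm_nonneg r)

end bounds

/-! ### The GNS construction for positive functionals on *-algebras -/

/-- A linear functional on a complex *-algebra that is nonnegative on the squares `s† s`. -/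
structure PositiveFunctional (R : Type u) [Ring R] [StarRing R] [Algebra ℂ R] where
  toLinearMap : R →ₗ[ℂ] ℂ
  nonneg : ∀ s, 0 ≤ toLinearMap (star s * s)

namespace PositiveFunctional

open UniformSpace ContinuousLinearMap

variable {R : Type u} [Ring R] [StarRing R] [Algebra ℂ R] [StarModule ℂ R]

/-- The values at the squares of `x + y` and `x + i y` are real; their vanishing imaginary parts
give the two components of Hermitian symmetry. -/
lemma conj_map (f : PositiveFunctional R) (x y : R) :
    star (f.toLinearMap (star y * x)) = f.toLinearMap (star x * y) := by
  have h1 := f.nonneg (x + y)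
  have h2 := f.nonneg (x + Complex.I • y)
  have hx := f.nonneg x
  have hy := f.nonneg y
  have hI : star Complex.I = -Complex.I := Complex.conj_I
  simp only [star_add, add_mul, mul_add, map_add, star_smul, smul_mul_assoc, mul_smul_comm,
    map_smul, smul_eq_mul, hI] at h1 h2
  rw [Complex.le_def] at h1 h2 hx hy
  replace h1 := h1.2
  replace h2 := h2.2
  replace hx := hx.2
  replace hy := hy.2
  simp at h1 h2 hx hy
  refine Complex.ext ?_ ?_
  · simp
    linarith
  · simp
    linarith

/-- The *-algebra `R` with the semi-inner product `⟨x, y⟩ = f (x† y)`. -/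
@[nolint unusedArguments]
def PreGNS (_f : PositiveFunctional R) : Type u := R

variable (f g : PositiveFunctional R)

noncomputable instance : AddCommGroup f.PreGNS := inferInstanceAs (AddCommGroup R)

noncomputable instance : Module ℂ f.PreGNS := inferInstanceAs (Module ℂ R)

/-- The identity map from the *-algebra to its semi-inner product space. -/
noncomputable def toPreGNS : R ≃ₗ[ℂ] f.PreGNS := LinearEquiv.refl ℂ _

/-- The semi-inner product of a positive functional. -/
noncomputable abbrev preInnerCore : PreInnerProductSpace.Core ℂ f.PreGNS where
  inner x y := f.toLinearMap (star (f.toPreGNS.symm x) * f.toPreGNS.symm y)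
  conj_inner_symm x y := f.conj_map _ _
  re_inner_nonneg x := (Complex.le_def.1 (f.nonneg _)).1
  add_left x y z := by rw [map_add, star_add, add_mul, map_add]
  smul_left x y r := by
    rw [map_smul, star_smul, smul_mul_assoc, map_smul]
    rfl

noncomputable instance : SeminormedAddCommGroup f.PreGNS :=
  InnerProductSpace.Core.toSeminormedAddCommGroup (c := f.preInnerCore)

noncomputable instance : InnerProductSpace ℂ f.PreGNS :=
  InnerProductSpace.ofCore f.preInnerCore

lemma inner_toPreGNS (x y : R) :
    inner ℂ (f.toPreGNS x) (f.toPreGNS y) = f.toLinearMap (star x * y) := rfl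

lemma norm_sq_toPreGNS (x : R) :
    ((‖f.toPreGNS x‖ ^ 2 : ℝ) : ℂ) = f.toLinearMap (star x * x) := by
  rw [← inner_toPreGNS]
  simp

/-- A linear map between semi-inner product spaces of positive functionals that is contractive
by a comparison of the functionals. -/
noncomputable def contraction (T : R →ₗ[ℂ] R)
    (h : ∀ x, g.toLinearMap (star (T x) * T x) ≤ f.toLinearMap (star x * x)) :
    f.PreGNS →L[ℂ] g.PreGNS :=
  (g.toPreGNS.toLinearMap ∘ₗ T ∘ₗ f.toPreGNS.symm.toLinearMap).mkContinuous 1 fun x => by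
    obtain ⟨x, rfl⟩ := f.toPreGNS.surjective x
    rw [one_mul, ← sq_le_sq₀ (norm_nonneg _) (norm_nonneg _), ← Complex.real_le_real,
      norm_sq_toPreGNS]
    exact (norm_sq_toPreGNS g (T x)).le.trans (h x)

lemma contraction_toPreGNS (T : R →ₗ[ℂ] R)
    (h : ∀ x, g.toLinearMap (star (T x) * T x) ≤ f.toLinearMap (star x * x)) (x : R) :
    f.contraction g T h (f.toPreGNS x) = g.toPreGNS (T x) := rfl

/-- The Hilbert space of a positive functional. -/
abbrev GNS : Type u := Completion f.PreGNS

/-- The vector of the Hilbert space defined by an element of the *-algebra. -/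
noncomputable def vec (x : R) : f.GNS := (f.toPreGNS x : Completion f.PreGNS)

lemma inner_vec (x y : R) : inner ℂ (f.vec x) (f.vec y) = f.toLinearMap (star x * y) :=
  Completion.inner_coe _ _

/-- The vectors `f.vec x` are dense, so matrix entries between them determine a bounded operator. -/
lemma eq_of_inner_vec {S T : f.GNS →L[ℂ] f.GNS}
    (h : ∀ x y, inner ℂ (f.vec x) (S (f.vec y)) = inner ℂ (f.vec x) (T (f.vec y))) : S = T := by
  refine ContinuousLinearMap.ext fun v => ext_inner_left ℂ fun w => ?_
  induction w, v using Completion.induction_on₂ with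
  | hp => apply isClosed_eq <;> fun_prop
  | ih x y => exact h (f.toPreGNS.symm x) (f.toPreGNS.symm y)

/-- Left multiplication by a projection, on the Hilbert space of a positive functional. -/
lemma exists_leftMul {n : R} (hstar : star n = n) (hidem : n * n = n) :
    ∃ T : f.GNS →L[ℂ] f.GNS, T.IsPositive ∧ ∀ x, T (f.vec x) = f.vec (n * x) := by
  have hnn : ∀ x, star (n * x) * (n * x) = star x * (n * x) := fun x => by
    rw [star_mul, hstar, mul_assoc, ← mul_assoc n n, hidem]
  -- Boundedness uses no norm on `R`: positivity at `x - n x` makes multiplication by a projection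
  -- contractive.
  let T := (f.contraction f (LinearMap.mulLeft ℂ n) fun x => by
    have h := f.nonneg (x - n * x)
    have e : star (x - n * x) * (x - n * x) = star x * x - star (n * x) * (n * x) := by
      rw [star_sub, sub_mul, mul_sub, mul_sub, hnn, star_mul, hstar, mul_assoc]
      abel
    rwa [e, map_sub, sub_nonneg] at h).completion
  have hT : ∀ x, T (f.vec x) = f.vec (n * x) := fun x => completion_apply_coe _ _
  refine ⟨T, (isPositive_iff _).2 ⟨fun v w => ?_, fun v => ?_⟩, hT⟩
  · change inner ℂ (T v) w = inner ℂ v (T w)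
    induction v, w using Completion.induction_on₂ with
    | hp => apply isClosed_eq <;> fun_prop
    | ih x y =>
      change inner ℂ (T (f.vec (f.toPreGNS.symm x))) (f.vec (f.toPreGNS.symm y)) =
        inner ℂ (f.vec (f.toPreGNS.symm x)) (T (f.vec (f.toPreGNS.symm y)))
      rw [hT, hT, inner_vec, inner_vec, star_mul, hstar, mul_assoc]
  · induction v using Completion.induction_on with
    | hp => exact isClosed_le continuous_const (by fun_prop)
    | ih x =>
      change 0 ≤ inner ℂ (T (f.vec (f.toPreGNS.symm x))) (f.vec (f.toPreGNS.symm x))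
      rw [hT, inner_vec, star_mul, hstar, mul_assoc, ← hnn]
      exact f.nonneg _

/-- The Radon–Nikodym derivative of a dominated positive functional. -/
lemma exists_derivative (h : ∀ x, g.toLinearMap (star x * x) ≤ f.toLinearMap (star x * x)) :
    ∃ T : f.GNS →L[ℂ] f.GNS, T.IsPositive ∧
      ∀ x y, inner ℂ (f.vec x) (T (f.vec y)) = g.toLinearMap (star x * y) := by
  -- Domination makes the identity of `R` a contraction `T` between the two GNS spaces; the
  -- derivative is `T† T`.
  let T : f.GNS →L[ℂ] g.GNS := (f.contraction g LinearMap.id h).completion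
  have hT : ∀ x, T (f.vec x) = g.vec x := fun x => completion_apply_coe _ _
  refine ⟨adjoint T ∘L T, isPositive_adjoint_comp_self T, fun x y => ?_⟩
  rw [comp_apply, adjoint_inner_right, hT, hT, inner_vec]

end PositiveFunctional

/-! ### Commuting strategies from positive functionals. -/

/-- Positive functionals with a common normalized marginal give a commuting operator strategy. -/
theorem exists_strategy_of_positiveFunctional {X Y A B R : Type u} [Fintype A] [Fintype B]
    [Nonempty X] [Ring R] [StarRing R] [Algebra ℂ R] [StarModule ℂ R]
    (F : A → X → PositiveFunctional R)
    (hF : ∀ x x', ∑ a, (F a x).toLinearMap = ∑ a, (F a x').toLinearMap)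
    (hF1 : ∀ x, ∑ a, (F a x).toLinearMap 1 = 1)
    (n : B → Y → R) (hstar : ∀ b y, star (n b y) = n b y)
    (hidem : ∀ b y, n b y * n b y = n b y) (hsum : ∀ y, ∑ b, n b y = 1) :
    ∃ (H : Type u) (_ : NormedAddCommGroup H) (_ : InnerProductSpace ℂ H) (_ : CompleteSpace H)
      (S : CommutingStrategy X Y A B H),
      ∀ a b x y, S.corr a b x y = ((F a x).toLinearMap (n b y)).re := by
  obtain ⟨x₀⟩ := ‹Nonempty X›
  let f : PositiveFunctional R :=
    { toLinearMap := ∑ a, (F a x₀).toLinearMap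
      nonneg := fun s => by
        rw [LinearMap.sum_apply]
        exact Finset.sum_nonneg fun a _ => (F a x₀).nonneg s }
  have hf : ∀ x s, f.toLinearMap s = ∑ a, (F a x).toLinearMap s := fun x s => by
    rw [← LinearMap.sum_apply, hF x x₀]
  have hdom : ∀ a x s, (F a x).toLinearMap (star s * s) ≤ f.toLinearMap (star s * s) :=
    fun a x s => by
      rw [hf x]
      exact Finset.single_le_sum (f := fun a => (F a x).toLinearMap (star s * s))
        (fun a _ => (F a x).nonneg s) (Finset.mem_univ a)
  choose M hMpos hM using fun a x => f.exists_derivative (F a x) (hdom a x)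
  choose T hTpos hT using fun b y => f.exists_leftMul (hstar b y) (hidem b y)
  have hTi : ∀ b y s t, inner ℂ (f.vec s) (T b y t) = inner ℂ (f.vec (n b y * s)) t :=
    fun b y s t => by
      rw [← hT]
      exact ((hTpos b y).isSymmetric _ _).symm
  refine ⟨f.GNS, inferInstance, inferInstance, inferInstance,
    { psi := f.vec 1, norm_psi := ?_, opA := M, opB := T, opA_pos := hMpos, opB_pos := hTpos,
      opA_sum := fun x => ?_, opB_sum := fun y => ?_, commute := fun a b x y => ?_ },
    fun a b x y => ?_⟩
  · have h := inner_self_eq_norm_sq_to_K (𝕜 := ℂ) (f.vec 1)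
    rw [f.inner_vec, star_one, one_mul, hf x₀, hF1] at h
    have h2 : ‖f.vec 1‖ ^ 2 = 1 := by
      rw [← Complex.ofReal_inj, Complex.ofReal_pow]
      exact h.symm
    exact (pow_eq_one_iff_of_nonneg (norm_nonneg _) two_ne_zero).1 h2
  · refine f.eq_of_inner_vec fun s t => ?_
    rw [_root_.sum_apply, inner_sum, one_apply_eq_self, f.inner_vec, hf x]
    simp only [hM]
  · refine f.eq_of_inner_vec fun s t => ?_
    rw [_root_.sum_apply, inner_sum, one_apply_eq_self]
    simp only [hT, f.inner_vec]
    rw [← map_sum, ← Finset.mul_sum, ← Finset.sum_mul, hsum, one_mul]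
  -- Left multiplication by `n b y` can be put on `t` or, being self-adjoint, on `s`; both orders of
  -- the product have the entry `F a x (s† n t)`.
  · refine f.eq_of_inner_vec fun s t => ?_
    rw [mul_apply_eq_comp, mul_apply_eq_comp, hTi, hT, hM, hM, star_mul,
      hstar, mul_assoc]
  · change (inner ℂ (f.vec 1) ((M a x * T b y) (f.vec 1))).re = _
    rw [mul_apply_eq_comp, hT, hM, star_one, one_mul, mul_one]

/-! ### Simultaneous Naimark dilation. -/

section dilation

variable {B L : Type*} [DecidableEq B] [Ring L]

/-- The self-adjoint unitary completion of the isometric column `v`. -/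
def dilationUnitary (v : B → L) : CStarMatrix (Option B) (Option B) L :=
  CStarMatrix.ofMatrix fun
    | none, none => 0
    | none, some c => v c
    | some b, none => v b
    | some b, some c => (if b = c then 1 else 0) - v b * v c

/-- The diagonal projections that dilate to a PVM with compression `v b ^ 2`. -/
def dilationDiag (b₀ b : B) : CStarMatrix (Option B) (Option B) L :=
  CStarMatrix.ofMatrix (Matrix.diagonal fun c => if c.getD b₀ = b then 1 else 0)

lemma star_dilationDiag [StarRing L] (b₀ b : B) :
    star (dilationDiag b₀ b : CStarMatrix (Option B) (Option B) L) = dilationDiag b₀ b := by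
  refine (Matrix.diagonal_conjTranspose _).trans (congrArg Matrix.diagonal (funext fun c => ?_))
  simp only [Pi.star_apply]
  split_ifs <;> simp

lemma dilationUnitary_none_none (v : B → L) : dilationUnitary v none none = 0 := rfl

lemma dilationUnitary_none_some (v : B → L) (c : B) : dilationUnitary v none (some c) = v c := rfl

lemma dilationUnitary_some_none (v : B → L) (b : B) : dilationUnitary v (some b) none = v b := rfl

lemma dilationUnitary_some_some (v : B → L) (b c : B) :
    dilationUnitary v (some b) (some c) = (if b = c then 1 else 0) - v b * v c := rfl

lemma dilationDiag_apply (b₀ b : B) (i j : Option B) :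
    (dilationDiag b₀ b : CStarMatrix (Option B) (Option B) L) i j =
      if i = j then (if i.getD b₀ = b then 1 else 0) else 0 := Matrix.diagonal_apply _ _ _

lemma star_dilationUnitary [StarRing L] {v : B → L} (hv : ∀ b, star (v b) = v b) :
    star (dilationUnitary v) = dilationUnitary v := by
  ext i j
  rw [CStarMatrix.star_apply]
  rcases i with _ | b <;> rcases j with _ | c <;>
    simp [dilationUnitary_none_none, dilationUnitary_none_some, dilationUnitary_some_none,
      dilationUnitary_some_some, hv, apply_ite star, eq_comm]

variable [Fintype B]

lemma dilationDiag_mul (b₀ b b' : B) :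
    (dilationDiag b₀ b : CStarMatrix (Option B) (Option B) L) * dilationDiag b₀ b' =
      if b = b' then dilationDiag b₀ b else 0 := by
  have h := Matrix.diagonal_mul_diagonal (fun c : Option B => if c.getD b₀ = b then (1 : L) else 0)
    (fun c : Option B => if c.getD b₀ = b' then (1 : L) else 0)
  refine Eq.trans h ?_
  split_ifs with hb
  · subst hb
    refine congrArg Matrix.diagonal (funext fun c => ?_)
    split_ifs <;> simp
  · refine (congrArg Matrix.diagonal (funext fun c => ?_)).trans Matrix.diagonal_zero
    split_ifs with h1 h2
    · exact absurd (h1.symm.trans h2) hb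
    all_goals simp

/-- The extra index `none` is assigned to `b₀`, so every index is counted for exactly one `b`. -/
lemma sum_dilationDiag (b₀ : B) :
    ∑ b, (dilationDiag b₀ b : CStarMatrix (Option B) (Option B) L) = 1 := by
  ext i j
  rw [CStarMatrix.one_apply]
  have h2 : (∑ b, (dilationDiag b₀ b : CStarMatrix (Option B) (Option B) L)) i j =
      ∑ b, (dilationDiag b₀ b : CStarMatrix (Option B) (Option B) L) i j :=
    Matrix.sum_apply i j Finset.univ _
  rw [h2]
  simp only [dilationDiag_apply]
  split_ifs <;> simp

/-- In block form, for self-adjoint entries, the matrix is `[[0, v†], [v, 1 - v v†]]`. The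
hypothesis is `v† v = 1`, so `1 - v v†` is a projection that annihilates `v`. -/
lemma dilationUnitary_mul_self {v : B → L} (hv : ∑ b, v b * v b = 1) :
    dilationUnitary v * dilationUnitary v = 1 := by
  have h1 : ∀ c, ∑ b, v b * ((if b = c then 1 else 0) - v b * v c) = 0 := fun c => by
    simp_rw [mul_sub, Finset.sum_sub_distrib, ← mul_assoc, ← Finset.sum_mul, hv]
    simp
  have h2 : ∀ c, ∑ b, ((if c = b then 1 else 0) - v c * v b) * v b = 0 := fun c => by
    simp_rw [sub_mul, Finset.sum_sub_distrib, mul_assoc, ← Finset.mul_sum, hv]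
    simp
  ext i j
  rw [CStarMatrix.mul_apply, Fintype.sum_option, CStarMatrix.one_apply]
  rcases i with _ | b <;> rcases j with _ | c
  · simpa [dilationUnitary_none_none, dilationUnitary_none_some, dilationUnitary_some_none,
      dilationUnitary_some_some] using hv
  · simpa [dilationUnitary_none_none, dilationUnitary_none_some, dilationUnitary_some_none,
      dilationUnitary_some_some] using h1 c
  · simpa [dilationUnitary_none_none, dilationUnitary_none_some, dilationUnitary_some_none,
      dilationUnitary_some_some] using h2 b
  · change v b * v c + ∑ d, ((if b = d then 1 else 0) - v b * v d) *
      ((if d = c then 1 else 0) - v d * v c) = _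
    have h3 : ∀ d, ((if b = d then 1 else 0) - v b * v d) *
        ((if d = c then 1 else 0) - v d * v c) =
        (if b = d then 1 else 0) * ((if d = c then 1 else 0) - v d * v c) -
          v b * (v d * ((if d = c then 1 else 0) - v d * v c)) := fun d => by
      rw [sub_mul, mul_assoc]
    simp_rw [h3, Finset.sum_sub_distrib, ← Finset.mul_sum, h1]
    simp

/-- The `none` row and column of the unitary vanish at `none`, so the extra index given to `b₀` does
not contribute and only `some b` survives. -/
lemma dilation_corner (v : B → L) (b₀ b : B) :
    (dilationUnitary v * dilationDiag b₀ b * dilationUnitary v :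
      CStarMatrix (Option B) (Option B) L) none none = v b * v b := by
  simp [CStarMatrix.mul_apply, Fintype.sum_option, dilationDiag_apply,
    dilationUnitary_none_none, dilationUnitary_none_some, dilationUnitary_some_none]

/-- The matrices whose entries commute with a given element. -/
def commutantMatrices (n : Type*) [Fintype n] [DecidableEq n] [Algebra ℂ L] (T : L) :
    Subalgebra ℂ (CStarMatrix n n L) where
  carrier := {M | ∀ i j, Commute T (M i j)}
  mul_mem' {M M'} h h' i j := by
    rw [CStarMatrix.mul_apply]
    exact Commute.sum_right _ _ _ fun k _ => (h i k).mul_right (h' k j)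
  add_mem' {M M'} h h' i j := (h i j).add_right (h' i j)
  algebraMap_mem' r i j := by
    rw [Algebra.algebraMap_eq_smul_one, CStarMatrix.smul_apply, CStarMatrix.one_apply]
    split_ifs
    · exact (Commute.one_right T).smul_right r
    · exact (Commute.zero_right T).smul_right r

lemma dilationUnitary_mem_commutantMatrices [Algebra ℂ L] {v : B → L} {T : L}
    (h : ∀ b, Commute T (v b)) : dilationUnitary v ∈ commutantMatrices (Option B) T := by
  have hd : ∀ b c : B, Commute T (if b = c then 1 else 0) := fun b c => by
    split_ifs
    exacts [Commute.one_right T, Commute.zero_right T]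
  rintro (_ | b) (_ | c)
  exacts [Commute.zero_right T, h c, h b, (hd b c).sub_right ((h b).mul_right (h c))]

lemma dilationDiag_mem_commutantMatrices [Algebra ℂ L] (b₀ b : B) (T : L) :
    dilationDiag b₀ b ∈ commutantMatrices (Option B) T := by
  intro i j
  rw [dilationDiag_apply]
  split_ifs
  exacts [Commute.one_right T, Commute.zero_right T, Commute.zero_right T]

end dilation

/-- Restricting to polynomials lets `S` be any subalgebra, with no closedness required. -/
lemma map_mem_of_mem_polyLE {B Y : Type u} [Fintype B] {D : Type*} [Ring D] [Algebra ℂ D]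
    (π : PVMAlgebra B Y →ₐ[ℂ] D) (S : Subalgebra ℂ D) (h : ∀ b y, π (N b y) ∈ S) {k : ℕ}
    {z : PVMAlgebra B Y} (hz : z ∈ polyLE B Y k) : π z ∈ S := by
  have hle : polyLE B Y k ≤ Subalgebra.toSubmodule (S.comap π) := by
    refine Submodule.span_le.2 ?_
    rintro _ ⟨l, -, rfl⟩
    refine (S.comap π).list_prod_mem fun w hw => ?_
    obtain ⟨s, -, rfl⟩ := List.mem_map.1 hw
    exact h s.1 s.2
  exact hle hz

/-- Simultaneous Naimark dilation of a family of POVMs to a representation of the PVM algebra by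
matrices with operator entries, which commute with everything that commutes with the POVMs. -/
theorem exists_dilation {B Y : Type u} [Fintype B] [Nonempty B] {H : Type u}
    [NormedAddCommGroup H] [InnerProductSpace ℂ H] [CompleteSpace H] (E : B → Y → (H →L[ℂ] H))
    (hpos : ∀ b y, (E b y).IsPositive) (hsum : ∀ y, ∑ b, E b y = 1) :
    ∃ (n : Type u) (_ : Fintype n) (_ : DecidableEq n) (i₀ : n)
      (π : PVMAlgebra B Y →⋆ₐ[ℂ] CStarMatrix n n (H →L[ℂ] H)),
      (∀ b y, π (N b y) i₀ i₀ = E b y) ∧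
      ∀ T : H →L[ℂ] H, (∀ b y, Commute T (E b y)) → ∀ k, ∀ z ∈ polyLE B Y k, ∀ i j,
        Commute T (π z i j) := by
  classical
  obtain ⟨b₀⟩ := ‹Nonempty B›
  have hnn : ∀ b y, 0 ≤ E b y := fun b y =>
    (ContinuousLinearMap.nonneg_iff_isPositive _).2 (hpos b y)
  let v : Y → B → (H →L[ℂ] H) := fun y b => CFC.sqrt (E b y)
  have hvv : ∀ y b, v y b * v y b = E b y := fun y b => CFC.sqrt_mul_sqrt_self _ (hnn b y)
  have hvs : ∀ y b, star (v y b) = v y b := fun y b => (CFC.sqrt_nonneg _).isSelfAdjoint.star_eq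
  let U : Y → CStarMatrix (Option B) (Option B) (H →L[ℂ] H) := fun y => dilationUnitary (v y)
  have hUU : ∀ y, U y * U y = 1 := fun y => dilationUnitary_mul_self (by simp only [hvv, hsum])
  have hUs : ∀ y, star (U y) = U y := fun y => star_dilationUnitary (hvs y)
  let P : B → Y → CStarMatrix (Option B) (Option B) (H →L[ℂ] H) := fun b y =>
    U y * dilationDiag b₀ b * U y
  have hPP : ∀ b b' y, P b y * P b' y = if b = b' then P b y else 0 := fun b b' y => by
    have h : P b y * P b' y = U y * (dilationDiag b₀ b * (U y * U y) * dilationDiag b₀ b') * U y := by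
      simp only [P, mul_assoc]
    rw [h, hUU, mul_one, dilationDiag_mul]
    split_ifs
    · rfl
    · rw [mul_zero, zero_mul]
  obtain ⟨π, hπ⟩ := exists_lift P
    (fun b y => by simp only [P, star_mul, hUs, star_dilationDiag, mul_assoc])
    (fun b y => by rw [hPP, if_pos rfl]) (fun b b' y h => by rw [hPP, if_neg h])
    (fun y => by simp only [P, ← Finset.sum_mul, ← Finset.mul_sum, sum_dilationDiag, mul_one, hUU])
  refine ⟨Option B, inferInstance, inferInstance, none, π, fun b y => ?_,
    fun T hT k z hz => ?_⟩
  · rw [hπ, ← hvv]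
    exact dilation_corner _ _ _
  · have hU : ∀ y, U y ∈ commutantMatrices (Option B) T := fun y =>
      -- The square root of `E b y` comes from functional calculus, so it commutes with whatever
      -- commutes with `E b y`.
      dilationUnitary_mem_commutantMatrices fun b => ((hT b y).symm.cfcₙ_nnreal _).symm
    exact map_mem_of_mem_polyLE π.toAlgHom (commutantMatrices (Option B) T)
      (fun b y => by
        change π (N b y) ∈ _
        rw [hπ]
        exact mul_mem (mul_mem (hU y) (dilationDiag_mem_commutantMatrices _ _ _)) (hU y)) hz

/-! ### Feasible points from strategies. -/

/-- Every commuting operator strategy gives a feasible point at every level of the hierarchy. -/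
theorem CommutingStrategy.exists_feasible {X Y A B : Type u} [Fintype A] [Fintype B] [Nonempty B]
    {H : Type u} [NormedAddCommGroup H] [InnerProductSpace ℂ H] [CompleteSpace H]
    (S : CommutingStrategy X Y A B H) (d : ℕ) :
    ∃ φ : A → X → (polyLE B Y (2 * d) →ₗ[ℂ] ℂ), IsFeasible d φ ∧
      ∀ a b x y (h : N b y ∈ polyLE B Y (2 * d)), (φ a x ⟨N b y, h⟩).re = S.corr a b x y := by
  obtain ⟨n, _, _, i₀, π, hπ, hcomm⟩ := exists_dilation S.opB S.opB_pos S.opB_sum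
  let φ : A → X → (PVMAlgebra B Y →ₗ[ℂ] ℂ) := fun a x =>
    { toFun := fun z => inner ℂ S.psi (S.opA a x (π z i₀ i₀ S.psi))
      map_add' := fun z w => by
        have h : π (z + w) i₀ i₀ = π z i₀ i₀ + π w i₀ i₀ := by
          rw [map_add]
          rfl
        rw [h, ← inner_add_right]
        exact congrArg _ (map_add (S.opA a x) _ _)
      map_smul' := fun r z => by
        have h : π (r • z) i₀ i₀ = r • π z i₀ i₀ := by
          rw [map_smul]
          rfl
        rw [h, RingHom.id_apply, smul_eq_mul, ← inner_smul_right]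
        exact congrArg _ (map_smul (S.opA a x) _ _) }
  have hφ : ∀ a x z, φ a x z = inner ℂ S.psi (S.opA a x (π z i₀ i₀ S.psi)) := fun _ _ _ => rfl
  have hsum : ∀ x z, ∑ a, φ a x z = inner ℂ S.psi (π z i₀ i₀ S.psi) := fun x z => by
    simp only [hφ]
    rw [← inner_sum, ← _root_.sum_apply, S.opA_sum, one_apply_eq_self]
  refine ⟨fun a x => (φ a x).domRestrict _, ⟨fun x x' => ?_, fun x => ?_, fun a x s hs => ?_⟩,
    fun a b x y h => ?_⟩
  · refine LinearMap.ext fun z => ?_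
    rw [LinearMap.sum_apply, LinearMap.sum_apply]
    exact (hsum x z).trans (hsum x' z).symm
  · refine (hsum x 1).trans ?_
    rw [map_one, CStarMatrix.one_apply_eq, one_apply_eq_self, inner_self_eq_norm_sq_to_K,
      S.norm_psi]
    simp
  · change 0 ≤ φ a x (star s * s)
    rw [hφ, map_mul, map_star, CStarMatrix.mul_apply, _root_.sum_apply, map_sum, inner_sum]
    refine Finset.sum_nonneg fun j _ => ?_
    -- The corner of `π(s)† π(s)` is the sum over `j` of `T† T` with `T = π(s)_{j i₀}`. Moving
    -- `A_{ax}` past `T†` turns each term into `⟨T ψ, A_{ax} T ψ⟩ ≥ 0`.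
    have hc : Commute (S.opA a x) (star (π s j i₀)) := by
      have h := hcomm (S.opA a x) (fun b y => S.commute a b x y) d s hs j i₀
      have h' := h.star_star
      rwa [(S.opA_pos a x).isSelfAdjoint.star_eq] at h'
    rw [CStarMatrix.star_apply, mul_apply_eq_comp, ← mul_apply_eq_comp (S.opA a x), hc.eq,
      mul_apply_eq_comp, ContinuousLinearMap.star_eq_adjoint,
      ContinuousLinearMap.adjoint_inner_right]
    exact (S.opA_pos a x).inner_nonneg_right _
  · change (φ a x (N b y)).re = _
    rw [hφ, hπ]
    rfl

/-- The strategy that always answers `a₀` and `b₀`. -/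
lemma commutingValues_nonempty {X Y A B : Type u} [Fintype X] [Fintype Y] [Fintype A] [Fintype B]
    [Nonempty A] [Nonempty B] (G : NonlocalGame X Y A B) : (commutingValues G).Nonempty := by
  classical
  obtain ⟨a₀⟩ := ‹Nonempty A›
  obtain ⟨b₀⟩ := ‹Nonempty B›
  have hpos : ∀ p : Prop, [Decidable p] →
      ((if p then 1 else 0 : EuclideanSpace ℂ PUnit.{u + 1} →L[ℂ] _)).IsPositive := by
    intro p _
    split_ifs
    exacts [ContinuousLinearMap.isPositive_one, ContinuousLinearMap.isPositive_zero]
  let S : CommutingStrategy X Y A B (EuclideanSpace ℂ PUnit.{u + 1}) :=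
    { psi := EuclideanSpace.single PUnit.unit 1
      norm_psi := by simp
      opA := fun a _ => if a = a₀ then 1 else 0
      opB := fun b _ => if b = b₀ then 1 else 0
      opA_pos := fun a _ => hpos _
      opB_pos := fun b _ => hpos _
      opA_sum := fun _ => by simp
      opB_sum := fun _ => by simp
      commute := fun a b _ _ => by
        split_ifs
        exacts [Commute.one_left _, Commute.one_left _, Commute.zero_left _, Commute.zero_left _] }
  exact ⟨_, _, inferInstance, inferInstance, inferInstance, S, rfl⟩

lemma polyLE_mono {B Y : Type u} [Fintype B] {j k : ℕ} (h : j ≤ k) :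
    polyLE B Y j ≤ polyLE B Y k :=
  Submodule.span_mono fun _ ⟨l, hl, hw⟩ => ⟨l, hl.trans h, hw⟩

/-- The *-algebra of all polynomials in the generators of the PVM algebra. -/
noncomputable def polySubalgebra (B Y : Type u) [Fintype B] :
    StarSubalgebra ℂ (PVMAlgebra B Y) where
  carrier := {z | ∃ k, z ∈ polyLE B Y k}
  mul_mem' := fun ⟨j, hj⟩ ⟨k, hk⟩ => ⟨j + k, mul_mem_polyLE hj hk⟩
  add_mem' := fun ⟨j, hj⟩ ⟨k, hk⟩ => ⟨max j k,
    add_mem (polyLE_mono (le_max_left j k) hj) (polyLE_mono (le_max_right j k) hk)⟩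
  algebraMap_mem' r := ⟨0, by
    rw [Algebra.algebraMap_eq_smul_one]
    exact Submodule.smul_mem _ _ (one_mem_polyLE 0)⟩
  star_mem' := fun ⟨k, hk⟩ => ⟨k, star_mem_polyLE hk⟩

/-! ### Limits of feasible points. -/

section feasible

variable {X Y A B : Type u} [Fintype B]

/-- Extending to the whole algebra gives all levels a common domain for taking limits. The extension
is arbitrary beyond degree `2 d`, where the constraints say nothing. -/
lemma exists_eq_domRestrict {d : ℕ} (φ : A → X → (polyLE B Y (2 * d) →ₗ[ℂ] ℂ)) :
    ∃ g : A → X → (PVMAlgebra B Y →ₗ[ℂ] ℂ),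
      φ = fun a x => (g a x).domRestrict (polyLE B Y (2 * d)) := by
  choose g hg using fun a x => LinearMap.exists_extend (φ a x)
  exact ⟨g, funext fun a => funext fun x => (hg a x).symm⟩

variable [Fintype A]

lemma IsFeasible.map_one_le {d : ℕ} {g : A → X → (PVMAlgebra B Y →ₗ[ℂ] ℂ)}
    (hg : IsFeasible d fun a x => (g a x).domRestrict (polyLE B Y (2 * d))) (a : A) (x : X) :
    g a x 1 ≤ 1 := by
  have h0 : ∀ a', 0 ≤ g a' x 1 := fun a' => by
    have h := hg.positivity a' x 1 (one_mem_polyLE d)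
    simpa [LinearMap.domRestrict_apply] using h
  exact (Finset.single_le_sum (f := fun a' => g a' x 1) (fun a' _ => h0 a')
    (Finset.mem_univ a)).trans (hg.identity x).le

/-- Feasible points converge along an ultrafilter, on all polynomials whose degree is eventually
covered by the level, and the limit inherits the constraints. -/
theorem exists_limit_of_isFeasible {ι : Type*} (U : Ultrafilter ι) {D : ι → ℕ}
    {g : ι → A → X → (PVMAlgebra B Y →ₗ[ℂ] ℂ)}
    (hg : ∀ i, IsFeasible (D i) fun a x => (g i a x).domRestrict (polyLE B Y (2 * D i)))
    (V : Submodule ℂ (PVMAlgebra B Y))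
    (hV : ∀ z ∈ V, ∃ k, z ∈ polyLE B Y (2 * k) ∧ ∀ᶠ i in U, k ≤ D i) :
    ∃ F : A → X → (V →ₗ[ℂ] ℂ),
      (∀ a x (z : V), Tendsto (fun i => g i a x z) U (𝓝 (F a x z))) ∧
      (∀ x x', ∑ a, F a x = ∑ a, F a x') ∧
      (∀ x (h : 1 ∈ V), ∑ a, F a x ⟨1, h⟩ = 1) ∧
      ∀ a x s k, s ∈ polyLE B Y k → (∀ᶠ i in U, k ≤ D i) → ∀ h : star s * s ∈ V,
        0 ≤ F a x ⟨star s * s, h⟩ := by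
  choose F hF using fun a x => exists_tendsto_ultrafilter U
    (fun i => (g i a x).domRestrict V) fun z => by
      obtain ⟨k, hk, hD⟩ := hV z z.2
      obtain ⟨C, hC⟩ := exists_forall_norm_le hk
      exact ⟨C, hD.mono fun i hi => hC _ hi _ ((hg i).positivity a x) ((hg i).map_one_le a x)⟩
  refine ⟨F, hF, fun x x' => ?_, fun x h => ?_, fun a x s k hs hk h => ?_⟩
  · refine LinearMap.ext fun z => ?_
    rw [LinearMap.sum_apply, LinearMap.sum_apply]
    obtain ⟨k, hk, hD⟩ := hV z z.2
    refine tendsto_nhds_unique (tendsto_finsetSum _ fun a _ => hF a x z)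
      -- The marginals agree at `z` only once the level covers its degree, hence an eventual
      -- equality.
      ((tendsto_finsetSum _ fun a _ => hF a x' z).congr' (hD.mono fun i hi => ?_))
    have hz : (z : PVMAlgebra B Y) ∈ polyLE B Y (2 * D i) :=
      polyLE_mono (Nat.mul_le_mul_left 2 hi) hk
    have h := LinearMap.congr_fun ((hg i).consistency x' x) ⟨z, hz⟩
    rw [LinearMap.sum_apply, LinearMap.sum_apply] at h
    exact h
  · refine tendsto_nhds_unique (tendsto_finsetSum _ fun a _ => hF a x ⟨1, h⟩) ?_
    exact tendsto_const_nhds.congr fun i => ((hg i).identity x).symm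
  · refine ge_of_tendsto (hF a x ⟨_, h⟩) (hk.mono fun i hi => ?_)
    exact (hg i).positivity a x s (polyLE_mono hi hs)

end feasible

/-! ### Attainment and convergence of the values. -/

section values

variable {X Y A B : Type u} [Fintype X] [Fintype Y] [Fintype A] [Fintype B]

lemma mem_oneSidedValues_of_mem_commutingValues [Nonempty B] {G : NonlocalGame X Y A B} {w : ℝ}
    (hw : w ∈ commutingValues G) (d : ℕ+) : w ∈ oneSidedValues G d := by
  obtain ⟨H, _, _, _, S, rfl⟩ := hw
  obtain ⟨φ, hφ, hφS⟩ := S.exists_feasible (d : ℕ)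
  exact ⟨φ, hφ, by simp only [objective, hφS]⟩

lemma bddAbove_oneSidedValues (G : NonlocalGame X Y A B) (d : ℕ+) :
    BddAbove (oneSidedValues G d) := by
  choose C hC using fun (b : B) (y : Y) =>
    exists_forall_norm_le (N_mem_polyLE (Nat.mul_pos two_pos d.pos) b y)
  refine ⟨∑ a, ∑ b, ∑ x, ∑ y, |G.coeff a b x y| * C b y, ?_⟩
  rintro _ ⟨φ, hφ, rfl⟩
  obtain ⟨g, rfl⟩ := exists_eq_domRestrict φ
  refine Finset.sum_le_sum fun a _ => Finset.sum_le_sum fun b _ => Finset.sum_le_sum fun x _ =>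
    Finset.sum_le_sum fun y _ => (le_abs_self _).trans ?_
  rw [abs_mul]
  exact mul_le_mul_of_nonneg_left ((Complex.abs_re_le_norm _).trans
    (hC b y d le_rfl (g a x) (hφ.positivity a x) (hφ.map_one_le a x))) (abs_nonneg _)

lemma tendsto_objective {ι : Type*} {l : Filter ι} {g : ι → A → X → (PVMAlgebra B Y →ₗ[ℂ] ℂ)}
    {F : A → X → B → Y → ℂ}
    (h : ∀ a b x y, Tendsto (fun i => g i a x (N b y)) l (𝓝 (F a x b y)))
    (G : NonlocalGame X Y A B) (D : ι → ℕ+) :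
    Tendsto (fun i => objective G (D i) fun a x => (g i a x).domRestrict (polyLE B Y (2 * D i))) l
      (𝓝 (∑ a, ∑ b, ∑ x, ∑ y, G.coeff a b x y * (F a x b y).re)) :=
  tendsto_finsetSum _ fun a _ => tendsto_finsetSum _ fun b _ => tendsto_finsetSum _ fun x _ =>
    tendsto_finsetSum _ fun y _ =>
      ((Complex.continuous_re.tendsto _).comp (h a b x y)).const_mul _

/-- The optimal value of every level of the hierarchy is attained. -/
theorem isGreatest_oneSidedValue [Nonempty A] [Nonempty B] (G : NonlocalGame X Y A B) (d : ℕ+) :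
    IsGreatest (oneSidedValues G d) (oneSidedValue G d) := by
  have hne : (oneSidedValues G d).Nonempty :=
    (commutingValues_nonempty G).imp fun w hw => mem_oneSidedValues_of_mem_commutingValues hw d
  refine ⟨?_, fun w hw => le_csSup (bddAbove_oneSidedValues G d) hw⟩
  obtain ⟨v, -, hv, hmem⟩ := exists_seq_tendsto_sSup hne (bddAbove_oneSidedValues G d)
  choose φ hφ hφv using hmem
  choose g hg using fun i => exists_eq_domRestrict (φ i)
  obtain rfl : φ = _ := funext hg
  let U : Ultrafilter ℕ := hyperfilter ℕ
  have hU : (U : Filter ℕ) ≤ atTop := Nat.hyperfilter_le_atTop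
  obtain ⟨F, hF, hcons, hone, hpos⟩ := exists_limit_of_isFeasible U hφ (polyLE B Y (2 * d))
    fun z hz => ⟨d, hz, Eventually.of_forall fun _ => le_rfl⟩
  refine ⟨F, ⟨hcons, fun x => hone x _, fun a x s hs =>
    hpos a x s d hs (Eventually.of_forall fun _ => le_rfl) _⟩, ?_⟩
  have hlim := tendsto_objective (fun a b x y => hF a x ⟨N b y, N_mem_polyLE
    (Nat.mul_pos two_pos d.pos) b y⟩) G fun _ => d
  refine tendsto_nhds_unique (hv.mono_left hU) (hlim.congr fun i => (hφv i).symm)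

/-- Along every ultrafilter that tends to infinity, the values of feasible points of increasing
level converge to the winning probability of a commuting operator strategy. -/
theorem exists_commutingValues_tendsto (G : NonlocalGame X Y A B) (U : Ultrafilter ℕ+)
    (hU : (U : Filter ℕ+) ≤ atTop) {v : ℕ+ → ℝ} (hv : ∀ d, v d ∈ oneSidedValues G d) :
    ∃ w ∈ commutingValues G, Tendsto v U (𝓝 w) := by
  choose φ hφ hφv using hv
  choose g hg using fun d => exists_eq_domRestrict (φ d)
  obtain rfl : φ = _ := funext hg
  have hev : ∀ k : ℕ, ∀ᶠ d : ℕ+ in U, k ≤ d := fun k =>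
    hU ((eventually_ge_atTop (⟨k + 1, k.succ_pos⟩ : ℕ+)).mono fun d hd =>
      (Nat.le_succ k).trans hd)
  let R := polySubalgebra B Y
  -- Every degree is eventually covered, so the limit lives on all polynomials and is positive on
  -- all their squares.
  obtain ⟨F, hF, hcons, hone, hpos⟩ := exists_limit_of_isFeasible U hφ
    (Subalgebra.toSubmodule R.toSubalgebra) fun z ⟨k, hk⟩ =>
      ⟨k, polyLE_mono (by omega) hk, hev k⟩
  -- A question is needed to define the common marginal; without one the probabilities would sum to
  -- `0`.
  have hX : Nonempty X := by
    by_contra h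
    have := not_nonempty_iff.1 h
    simpa using G.prob_sum
  let n : B → Y → R := fun b y => ⟨N b y, 1, N_mem_polyLE le_rfl b y⟩
  obtain ⟨H, _, _, _, S, hS⟩ := exists_strategy_of_positiveFunctional (R := R)
    (fun a x => { toLinearMap := F a x, nonneg := fun ⟨s, k, hs⟩ => hpos a x s k hs (hev k) _ })
    hcons (fun x => hone x _) n (fun b y => Subtype.ext (star_N b y))
    (fun b y => Subtype.ext (N_mul_self b y))
    (fun y => Subtype.ext ((AddSubmonoidClass.coe_finsetSum _ _).trans (sum_N y)))
  refine ⟨_, ⟨H, _, _, _, S, rfl⟩, ?_⟩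
  simp only [hS]
  exact (tendsto_objective (fun a b x y => hF a x (n b y)) G fun d => d).congr
    fun d => (hφv d).symm

end values

end OneSidedNPA

theorem theorem4p1 {X Y A B : Type u} [Fintype X] [Fintype Y] [Fintype A] [Fintype B]
    [Nonempty A] [Nonempty B] (G : OneSidedNPA.NonlocalGame X Y A B) :
    (∀ d : ℕ+, IsGreatest (OneSidedNPA.oneSidedValues G d) (OneSidedNPA.oneSidedValue G d)) ∧
      IsLUB (OneSidedNPA.commutingValues G) (OneSidedNPA.commutingValue G) ∧
      Filter.Tendsto (fun d : ℕ+ => OneSidedNPA.oneSidedValue G d) Filter.atTop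
        (nhds (OneSidedNPA.commutingValue G)) := by
  have hmax := OneSidedNPA.isGreatest_oneSidedValue G
  have hne := OneSidedNPA.commutingValues_nonempty G
  have hle : ∀ d w, w ∈ OneSidedNPA.commutingValues G → w ≤ OneSidedNPA.oneSidedValue G d :=
    fun d w hw => (hmax d).2 (OneSidedNPA.mem_oneSidedValues_of_mem_commutingValues hw d)
  have hlub : IsLUB (OneSidedNPA.commutingValues G) (OneSidedNPA.commutingValue G) :=
    isLUB_csSup hne ⟨_, hle 1⟩
  -- Testing convergence on ultrafilters avoids monotonicity in `d`: each limit is at most the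
  -- commuting value, being a commuting value itself, and at least it, since every level value is.
  refine ⟨hmax, hlub, Filter.tendsto_iff_ultrafilter _ _ _ |>.2 fun U hU => ?_⟩
  obtain ⟨w, hw, hlim⟩ :=
    OneSidedNPA.exists_commutingValues_tendsto G U hU fun d => (hmax d).1
  have h : w = OneSidedNPA.commutingValue G :=
    le_antisymm (hlub.1 hw) (ge_of_tendsto' hlim fun d => hlub.2 (hle d))
  rwa [← h]
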